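/- Let $K$ be an arbitrary algebraically closed field and let $f=(f_1,\dots,f_m):K^n\to K^m$ be a polynomial map of degree $d=\max_i\deg f_i$. Let $Y=\overline{f(K^n)}\subset K^m$ be the Zariski closure of the image, and assume that $f$ is generically finite, i.e. that $f$ has finite fibres over a Zariski-open dense subset of $Y$. Let $S_f$ be the set of points $y\in Y$ at which $f$ is not proper; here $f$ is proper at $y\in Y$ if there is an affine Zariski-open neighbourhood $U\subset Y$ of $y$ such that $f^{-1}(U)$ is affine and $f|_{f^{-1}(U)}:f^{-1}(U)\to U$ is finite, i.e. the ring extension $K[U]\to K[f^{-1}(U)]$, $h\mapsto h\circ f$, is integral. Then $S_f$ is empty, or $S_f$ is a Zariski-closed subset of $K^m$ which has degree of $K$-uniruledness at most $d$: for every irreducible component $C$ of $S_f$ and every point $x\in C$ there is a parametric curve of degree at most $d$ that passes through $x$ and is contained in $C$. Here a parametric curve of degree at most $d$ is an affine curve (a one-dimensional Zariski-closed set) $\Gamma\subset K^m$ for which there is a dominant polynomial map $\varphi=(\varphi_1,\dots,\varphi_m):K\to\Gamma$ with $\deg\varphi_i\le d$ for all $i$. -/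

import Mathlib

/-! Affine varieties over a field `K` are Zariski-closed subsets of `K^m = (Fin m → K)`. -/

noncomputable section

namespace AffineGeometry

open MvPolynomial CategoryTheory AlgebraicGeometry

universe u

variable {K : Type u} [Field K]

/-- `V ⊆ K^m` is an affine variety (a Zariski-closed, possibly reducible set): the common zero
set of an ideal of polynomials. -/
def IsAffineVariety {m : ℕ} (V : Set (Fin m → K)) : Prop :=
  ∃ I : Ideal (MvPolynomial (Fin m) K), V = zeroLocus K I

theorem isAffineVariety_sInter {m : ℕ} (A : Set (Set (Fin m → K)))
    (hA : ∀ V ∈ A, IsAffineVariety V) : IsAffineVariety (⋂₀ A) := by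
  refine ⟨Ideal.span {p | ∃ V ∈ A, p ∈ vanishingIdeal K V}, ?_⟩
  rw [zeroLocus_span]
  ext x
  simp only [Set.mem_sInter, Set.mem_ofPred_eq]
  constructor
  · rintro hx p ⟨V, hV, hp⟩
    exact hp x (hx V hV)
  · intro hx V hV
    obtain ⟨I, hI⟩ := hA V hV
    rw [hI, mem_zeroLocus_iff]
    intro p hp
    exact hx p ⟨V, hV, hI ▸ le_vanishingIdeal_zeroLocus I hp⟩

theorem isAffineVariety_union {m : ℕ} (V W : Set (Fin m → K))
    (hV : IsAffineVariety V) (hW : IsAffineVariety W) : IsAffineVariety (V ∪ W) := by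
  obtain ⟨I, rfl⟩ := hV
  obtain ⟨J, rfl⟩ := hW
  refine ⟨I * J, ?_⟩
  ext x
  constructor
  · rintro (h | h)
    · exact zeroLocus_anti_mono (K := K) (Ideal.mul_le_left (I := I) (J := J)) h
    · exact zeroLocus_anti_mono (K := K) (Ideal.mul_le_right (I := I) (J := J)) h
  · intro h
    by_contra hx
    simp only [Set.mem_union, mem_zeroLocus_iff, not_or, not_forall] at hx
    obtain ⟨⟨p, hp, hpx⟩, q, hq, hqx⟩ := hx
    have := h (p * q) (Ideal.mul_mem_mul hp hq)
    rw [map_mul] at this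
    exact (mul_ne_zero hpx hqx) this

variable (K) in
/-- The Zariski topology on `K^m`: the closed sets are the affine varieties. -/
@[reducible] def zariskiTopology (m : ℕ) : TopologicalSpace (Fin m → K) :=
  TopologicalSpace.ofClosed {V | IsAffineVariety V} ⟨⊤, zeroLocus_top.symm⟩
    isAffineVariety_sInter fun V hV W hW => isAffineVariety_union V W hV hW

attribute [local instance] zariskiTopology

/-! ### Degree of `K`-uniruledness -/

/-- `C` is an irreducible component of `X`: a maximal irreducible subset of `X`. -/
def IsIrreducibleComponent {m : ℕ} (C X : Set (Fin m → K)) : Prop :=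
  Maximal (fun Z => IsIrreducible Z ∧ Z ⊆ X) C

/-- An affine curve in `K^m`: an affine variety of (Krull) dimension one. -/
def IsAffineCurve {m : ℕ} (Γ : Set (Fin m → K)) : Prop :=
  IsAffineVariety Γ ∧ topologicalKrullDim Γ = 1

/-- `Γ` is a parametric curve of degree at most `d`: an affine curve for which there is a dominant
polynomial map `φ = (φ₁, …, φₘ) : K → Γ` with all `deg φᵢ ≤ d`. -/
def IsParametricCurve {m : ℕ} (d : ℕ) (Γ : Set (Fin m → K)) : Prop :=
  IsAffineCurve Γ ∧ ∃ φ : Fin m → Polynomial K, (∀ i, (φ i).natDegree ≤ d) ∧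
    closure (Set.range fun (t : K) (i : Fin m) => (φ i).eval t) = Γ

/-- `X` has degree of `K`-uniruledness at most `d`: through every point of every irreducible
component of `X` there passes a parametric curve of degree at most `d` contained in that
component. -/
def HasUniruledDegreeAtMost {m : ℕ} (d : ℕ) (X : Set (Fin m → K)) : Prop :=
  ∀ C, IsIrreducibleComponent C X → ∀ x ∈ C, ∃ Γ ⊆ C, x ∈ Γ ∧ IsParametricCurve d Γ

/-! ### Polynomial maps `K^n → K^m`

Such a map is given by its components `f₁, …, fₘ ∈ K[x₁, …, xₙ]`. -/

variable {n m : ℕ}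

/-- The map `K^n → K^m` with components `f`. -/
def toMap (f : Fin m → MvPolynomial (Fin n) K) (x : Fin n → K) : Fin m → K :=
  fun i => eval x (f i)

/-- The degree `max_i deg f_i` of a polynomial map. -/
def mapDegree (f : Fin m → MvPolynomial (Fin n) K) : ℕ :=
  Finset.univ.sup fun i => (f i).totalDegree

/-- The Zariski closure `Y` of the image of the map. -/
def imageClosure (f : Fin m → MvPolynomial (Fin n) K) : Set (Fin m → K) :=
  closure (Set.range (toMap f))

/-- The map is generically finite: it has finite fibres over a Zariski-open dense subset of the
closure of its image. -/
def IsGenericallyFinite (f : Fin m → MvPolynomial (Fin n) K) : Prop :=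
  ∃ U : Set (Fin m → K), IsOpen U ∧ imageClosure f ⊆ closure (U ∩ imageClosure f) ∧
    ∀ y ∈ U ∩ imageClosure f, (toMap f ⁻¹' {y}).Finite

/-! ### The set of points at which the map is not proper -/

/-- The coordinate ring `K[Y]` of the closure of the image. -/
abbrev ImageCoordRing (f : Fin m → MvPolynomial (Fin n) K) : Type u :=
  MvPolynomial (Fin m) K ⧸ vanishingIdeal K (imageClosure f)

theorem aeval_eq_zero_of_mem [Infinite K] (f : Fin m → MvPolynomial (Fin n) K)
    (p : MvPolynomial (Fin m) K) (hp : p ∈ vanishingIdeal K (imageClosure f)) :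
    (aeval f : MvPolynomial (Fin m) K →ₐ[K] MvPolynomial (Fin n) K) p = 0 := by
  refine MvPolynomial.funext fun x => ?_
  have h := hp (toMap f x) (subset_closure ⟨x, rfl⟩)
  rw [map_zero, ← h]
  have e : (aeval x : MvPolynomial (Fin n) K →ₐ[K] K).comp (aeval f) = aeval (toMap f x) :=
    algHom_ext fun i => by simp [toMap, aeval_eq_eval]
  exact DFunLike.congr_fun e p

/-- The comorphism `K[Y] → K[x₁, …, xₙ]`, `h ↦ h ∘ f`. -/
def comorphism [Infinite K] (f : Fin m → MvPolynomial (Fin n) K) :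
    ImageCoordRing f →+* MvPolynomial (Fin n) K :=
  Ideal.Quotient.lift _ (aeval f : MvPolynomial (Fin m) K →ₐ[K] MvPolynomial (Fin n) K).toRingHom
    (aeval_eq_zero_of_mem f)

/-- The map `f : K^n → Y` as a morphism of affine schemes. -/
def schemeMap [Infinite K] (f : Fin m → MvPolynomial (Fin n) K) :
    Spec (.of (MvPolynomial (Fin n) K)) ⟶ Spec (.of (ImageCoordRing f)) :=
  Spec.map (CommRingCat.ofHom (comorphism f))

/-- Evaluation `K[Y] → K` at a point `y ∈ Y`. -/
def evalAt (f : Fin m → MvPolynomial (Fin n) K) (y : imageClosure f) :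
    ImageCoordRing f →+* K :=
  Ideal.Quotient.lift _ (eval (y : Fin m → K))
    fun p hp => by simpa [aeval_eq_eval] using hp y y.2

/-- The closed point of `Spec K[Y]` that corresponds to `y ∈ Y`, i.e. the maximal ideal of the
regular functions vanishing at `y`. -/
def schemePoint (f : Fin m → MvPolynomial (Fin n) K) (y : imageClosure f) :
    Spec (.of (ImageCoordRing f)) :=
  (⟨RingHom.ker (evalAt f y), RingHom.ker_isPrime _⟩ : PrimeSpectrum (ImageCoordRing f))

/-- `f` is proper at `y ∈ Y`: there is an affine open neighbourhood `U` of `y` in `Y` such that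
`f⁻¹(U)` is affine and `f : f⁻¹(U) → U` is finite, i.e. `K[U] → K[f⁻¹(U)]` is integral. -/
def IsProperAt [Infinite K] (f : Fin m → MvPolynomial (Fin n) K) (y : imageClosure f) : Prop :=
  ∃ U : (Spec (.of (ImageCoordRing f))).Opens, schemePoint f y ∈ U ∧ IsAffineOpen U ∧
    IsAffineOpen (schemeMap f ⁻¹ᵁ U) ∧ ((schemeMap f).app U).hom.IsIntegral

/-- The set `S_f` of the points of the closure of the image at which `f` is not proper. -/
def nonProperSet [Infinite K] (f : Fin m → MvPolynomial (Fin n) K) : Set (Fin m → K) :=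
  {y | ∃ hy : y ∈ imageClosure f, ¬ IsProperAt f ⟨y, hy⟩}

end AffineGeometry

end

/-!
The non-properness set is described by integrality, and curves in it are found as limits of lines
with respect to valuations of the function field.

*Closedness.* For a coordinate `xᵢ` of the source let `Jᵢ` be the ideal of the polynomials `a` on the
target such that `(a ∘ f) xᵢ` is integral over `K[f₁, …, fₘ]` (`coordinateDenominators`). Properness
at `y` means that the coordinates are integral over a localization `K[Y]ₕ` with `h(y) ≠ 0`
(`isProperAt_iff`), so the non-properness set is the union of the zero loci of the `Jᵢ`
(`nonProperSet_eq_zeroLocus`).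

*A curve through the generic point of a component.* Let `P` be the prime ideal of a component `V`.
Then `Jᵢ ≤ P` for some `i`. In an algebraic closure `F` of `K(x₁, …, xₙ)` there is a valuation ring `O`
that dominates `K[f₁, …, fₘ]` at `P` and has `1 / xᵢ` in its maximal ideal: a relation `h(1 / xᵢ) = 0`,
multiplied by a power of `xᵢ`, shows that the constant term of `h` lies in `Jᵢ`. If `n ≥ 2`, take
`j ≠ i` and restrict `f` to the line `x + s eⱼ` through the generic point `x`. By generic finiteness
the resulting curve `s ↦ f(x + s eⱼ)` over `F` is not constant; it has degree at most `d` and starts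
at `f(x)`, whose coordinates lie in `O`. After a rescaling `s ↦ c s` all its coefficients lie in `O`
and it reduces to a nonconstant curve over the residue field (`exists_rescaling`). This limit starts
at the generic point of `V`. It satisfies the equations `Jᵢ`, because along the line `xᵢ` is a
constant with `1 / xᵢ` in the maximal ideal, which forces `a ∘ f` to reduce to zero when
`(a ∘ f) xᵢ` is integral. The closure of the limit curve is therefore an irreducible subset of the
non-properness set containing `V`, hence equal to `V`. If `n = 1`, then `f` is finite and `Jᵢ` is
the unit ideal, so there are no components.

*A curve through every point.* For `x ∈ V` a second valuation ring, dominating the local ring of `V`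
at `x`, and a second rescaling yield a curve through `x` in `V` over some extension of `K`
(`exists_curve_through_specialization`); by the Nullstellensatz its coefficients specialise to `K`
(`exists_curve_over_base`). A nonconstant polynomial map from the line is finite, so that its image
is closed and has dimension one (`isParametricCurve_range`).
-/

noncomputable section

namespace AffineGeometry

open MvPolynomial CategoryTheory AlgebraicGeometry
open IsLocalRing (residue ResidueField)

universe u

attribute [local instance] zariskiTopology

/-! ### Integrality of the sections of a morphism of affine schemes -/

section

/-- Integrality over `R[1/h]` of an element `x / 1` of `S[1/h]` descends to integrality over `R` after
multiplication by a power of `h`. The map `R → S` need not be injective, so denominators are cleared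
twice: in the coefficients of the equation, and to lift the equation from `S[1/h]` to `S`. -/
theorem exists_isIntegralElem_pow_mul {R S R' S' : Type*} [CommRing R] [CommRing S]
    [CommRing R'] [CommRing S'] [Algebra R R'] [Algebra S S'] (φ : R →+* S) (h : R)
    [IsLocalization.Away h R'] [IsLocalization.Away (φ h) S'] (g : R' →+* S')
    (hg : g.comp (algebraMap R R') = (algebraMap S S').comp φ) (x : S)
    (hx : g.IsIntegralElem (algebraMap S S' x)) :
    ∃ N : ℕ, φ.IsIntegralElem (φ (h ^ N) * x) := by
  let _ : Algebra R' S' := g.toAlgebra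
  let _ : Algebra R S' := (g.comp (algebraMap R R')).toAlgebra
  have : IsScalarTower R R' S' := .of_algebraMap_eq fun _ => rfl
  have hx' : IsIntegral R' (algebraMap S S' x) := hx
  obtain ⟨⟨_, N, rfl⟩, hm⟩ :=
    hx'.exists_multiple_integral_of_isLocalization (Submonoid.powers h) _
  obtain ⟨q, hq, hq0⟩ := hm
  have e : (⟨h ^ N, N, rfl⟩ : Submonoid.powers h) • algebraMap S S' x =
      algebraMap S S' (φ (h ^ N) * x) := by
    rw [Submonoid.smul_def, Algebra.smul_def, map_mul]
    congr 1
    exact DFunLike.congr_fun hg (h ^ N)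
  have hq1 : algebraMap S S' (q.eval₂ φ (φ (h ^ N) * x)) = 0 := by
    rw [Polynomial.hom_eval₂, ← hg, ← e]
    exact hq0
  rw [← map_zero (algebraMap S S')] at hq1
  obtain ⟨⟨_, M, rfl⟩, hM⟩ := (IsLocalization.eq_iff_exists (Submonoid.powers (φ h)) S').1 hq1
  by_cases hn : Nontrivial R
  swap
  · rw [not_nontrivial_iff_subsingleton] at hn
    have : Subsingleton S := ⟨fun a b => by
      rw [← one_mul a, ← one_mul b, ← map_one φ, Subsingleton.elim (1 : R) 0]; simp⟩
    exact ⟨0, 0, Subsingleton.elim _ _, Subsingleton.elim _ _⟩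
  have h1 := RingHom.isIntegralElem_leadingCoeff_mul φ (Polynomial.C (h ^ M) * q)
    (φ (h ^ N) * x) (by
      rw [Polynomial.eval₂_mul, Polynomial.eval₂_C]
      simpa using hM)
  rw [Polynomial.leadingCoeff_mul_monic hq, Polynomial.leadingCoeff_C] at h1
  refine ⟨M + N, ?_⟩
  rw [pow_add, map_mul, mul_assoc]
  exact h1

/-- If the elements of `S` become integral over `R` after multiplication by a power of `h`, then
the localization `R[1/h] → S[1/h]` is integral. -/
theorem isIntegral_of_isLocalization_away {R S R' S' : Type*} [CommRing R] [CommRing S]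
    [CommRing R'] [CommRing S'] [Algebra R R'] [Algebra S S'] (φ : R →+* S) (h : R)
    [IsLocalization.Away h R'] [IsLocalization.Away (φ h) S'] (g : R' →+* S')
    (hg : g.comp (algebraMap R R') = (algebraMap S S').comp φ)
    (hx : ∀ x : S, ∃ N : ℕ, φ.IsIntegralElem (φ (h ^ N) * x)) : g.IsIntegral := by
  let _ : Algebra R' S' := g.toAlgebra
  have key (x : S) (hx : φ.IsIntegralElem x) : g.IsIntegralElem (algebraMap S S' x) := by
    obtain ⟨q, hq, hq0⟩ := hx
    refine ⟨q.map (algebraMap R R'), hq.map _, ?_⟩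
    rw [Polynomial.eval₂_map, hg, ← Polynomial.hom_eval₂, hq0, map_zero]
  have hunit (N : ℕ) : ∃ b : R', algebraMap R R' (h ^ N) * b = 1 := by
    have : IsUnit (algebraMap R R' (h ^ N)) := by
      rw [map_pow]; exact (IsLocalization.Away.algebraMap_isUnit h).pow N
    exact this.exists_right_inv
  have key2 (x : S) : g.IsIntegralElem (algebraMap S S' x) := by
    obtain ⟨N, hN⟩ := hx x
    obtain ⟨b, hb⟩ := hunit N
    have h2 := (g.isIntegralElem_map (x := b)).mul g (key _ hN)
    have e : g b * algebraMap S S' (φ (h ^ N) * x) = algebraMap S S' x := by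
      have := DFunLike.congr_fun hg (h ^ N)
      simp only [RingHom.comp_apply] at this
      rw [map_mul, ← this, ← mul_assoc, ← map_mul, mul_comm b, hb, map_one, one_mul]
    rwa [e] at h2
  intro z
  obtain ⟨x, ⟨_, N, rfl⟩, rfl⟩ := IsLocalization.exists_mk'_eq (Submonoid.powers (φ h)) z
  obtain ⟨b, hb⟩ := hunit N
  have e : IsLocalization.mk' S' x (⟨φ h ^ N, N, rfl⟩ : Submonoid.powers (φ h)) =
      g b * algebraMap S S' x := by
    rw [IsLocalization.mk'_eq_iff_eq_mul]
    have := DFunLike.congr_fun hg (h ^ N)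
    simp only [RingHom.comp_apply, map_pow φ] at this
    simp only
    rw [← this, mul_right_comm, ← map_mul, mul_comm b, hb, map_one, one_mul]
  rw [e]
  exact (g.isIntegralElem_map (x := b)).mul g (key2 x)

/-- The map on sections over `U` induced by `R → S` is compatible with the maps from `R` and `S`. -/
theorem comp_algebraMap_app {R S : CommRingCat.{u}} (φ : R ⟶ S) (U : (Spec R).Opens) :
    ((Spec.map φ).app U).hom.comp (algebraMap R Γ(Spec R, U)) =
      (algebraMap S Γ(Spec S, Spec.map φ ⁻¹ᵁ U)).comp φ.hom := by
  have := StructureSheaf.toOpen_comp_comap φ.hom U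
  exact congrArg CommRingCat.Hom.hom this

/-- The basic open set `D(h)`, typed as an open of the scheme `Spec R` rather than of the prime
spectrum, so that the `R`-algebra structure on its sections is found. -/
def specBasicOpen {R : CommRingCat.{u}} (h : R) : (Spec R).Opens := PrimeSpectrum.basicOpen h

theorem isLocalization_specBasicOpen {R : CommRingCat.{u}} (h : R) :
    IsLocalization.Away h Γ(Spec R, specBasicOpen h) :=
  StructureSheaf.IsLocalization.to_basicOpen R h

/-- If the sections over `f⁻¹(U)` are integral over those over `U ∋ p`, the integral equations restrict
to a basic open neighbourhood `D(h) ⊆ U` of `p`. -/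
theorem exists_isIntegralElem_of_isIntegral_app {R S : CommRingCat.{u}}
    (φ : R ⟶ S) (U : (Spec R).Opens) (p : PrimeSpectrum R) (hp : p ∈ U)
    (hU : ((Spec.map φ).app U).hom.IsIntegral) :
    ∃ h ∉ p.asIdeal, ∀ x, ∃ N : ℕ, φ.hom.IsIntegralElem (φ.hom (h ^ N) * x) := by
  obtain ⟨_, ⟨h, rfl⟩, hpV, hVU⟩ :=
    PrimeSpectrum.isTopologicalBasis_basic_opens.exists_subset_of_mem_open hp U.isOpen
  refine ⟨h, hpV, fun x => ?_⟩
  have hVU' : specBasicOpen h ≤ U := hVU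
  have := isLocalization_specBasicOpen h
  have : IsLocalization.Away (φ.hom h) Γ(Spec S, Spec.map φ ⁻¹ᵁ specBasicOpen h) :=
    isLocalization_specBasicOpen (φ.hom h)
  refine exists_isIntegralElem_pow_mul φ.hom h
    (((Spec.map φ).app (specBasicOpen h)).hom) (comp_algebraMap_app φ _) x ?_
  obtain ⟨q, hq, hq0⟩ := hU (algebraMap S Γ(Spec S, Spec.map φ ⁻¹ᵁ U) x)
  refine ⟨q.map ((Spec R).presheaf.map (homOfLE hVU').op).hom, hq.map _, ?_⟩
  have nat := congrArg CommRingCat.Hom.hom ((Spec.map φ).naturality (homOfLE hVU').op)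
  rw [CommRingCat.hom_comp, CommRingCat.hom_comp] at nat
  have := congrArg ((Spec S).presheaf.map ((TopologicalSpace.Opens.map
    (Spec.map φ).base).map (homOfLE hVU')).op).hom hq0
  rw [Polynomial.hom_eval₂, map_zero] at this
  rw [Polynomial.eval₂_map, nat]
  exact this

theorem isIntegral_app_basicOpen {R S : CommRingCat.{u}}
    (φ : R ⟶ S) (h : R) (hx : ∀ x : S, ∃ N : ℕ, φ.hom.IsIntegralElem (φ.hom (h ^ N) * x)) :
    ((Spec.map φ).app (specBasicOpen h)).hom.IsIntegral := by
  have := isLocalization_specBasicOpen h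
  have : IsLocalization.Away (φ.hom h) Γ(Spec S, Spec.map φ ⁻¹ᵁ specBasicOpen h) :=
    isLocalization_specBasicOpen (φ.hom h)
  exact isIntegral_of_isLocalization_away φ.hom h
    (((Spec.map φ).app (specBasicOpen h)).hom) (comp_algebraMap_app φ _) hx

end

/-! ### The non-properness set as a zero locus -/

section

/-- The ideal of the `a ∈ R` such that `a x` is integral over `R`, for an `R`-algebra `φ : R → S`
and `x ∈ S`. -/
def denominatorIdeal {R S : Type*} [CommRing R] [CommRing S] (φ : R →+* S) (x : S) : Ideal R where
  carrier := {a | φ.IsIntegralElem (φ a * x)}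
  zero_mem' := by simpa using φ.isIntegralElem_zero
  add_mem' {a b} ha hb := by
    have := RingHom.IsIntegralElem.add φ ha hb
    simpa [add_mul] using this
  smul_mem' a b hb := by
    have := RingHom.IsIntegralElem.mul φ (φ.isIntegralElem_map (x := a)) hb
    simpa [mul_assoc] using this

theorem mem_denominatorIdeal {R S : Type*} [CommRing R] [CommRing S] {φ : R →+* S} {x : S}
    {a : R} : a ∈ denominatorIdeal φ x ↔ φ.IsIntegralElem (φ a * x) := Iff.rfl

theorem isIntegralElem_comp_iff_of_surjective {R R' S : Type*} [CommRing R] [CommRing R']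
    [CommRing S] (π : R →+* R') (hπ : Function.Surjective π) (φ : R' →+* S) (x : S) :
    (φ.comp π).IsIntegralElem x ↔ φ.IsIntegralElem x := by
  constructor
  · rintro ⟨q, hq, hq0⟩
    exact ⟨q.map π, hq.map _, by rwa [Polynomial.eval₂_map]⟩
  · rintro ⟨q, hq, hq0⟩
    have hl : q ∈ Polynomial.lifts π := by
      rw [Polynomial.lifts_iff_coeff_lifts]
      exact fun k => hπ _
    obtain ⟨q', rfl, -, hq'⟩ := Polynomial.lifts_and_natDegree_eq_and_monic hl hq
    exact ⟨q', hq', by rwa [← Polynomial.eval₂_map]⟩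

/-- If every coordinate becomes integral after multiplication by a power of `h`, then so does
every polynomial. -/
theorem exists_isIntegralElem_of_forall_X {K σ R : Type*} [CommRing K] [CommRing R]
    (φ : R →+* MvPolynomial σ K) (hC : ∀ c, φ.IsIntegralElem (C c)) (h : R)
    (hX : ∀ i, ∃ N : ℕ, φ.IsIntegralElem (φ (h ^ N) * X i)) (p : MvPolynomial σ K) :
    ∃ N : ℕ, φ.IsIntegralElem (φ (h ^ N) * p) := by
  induction p using MvPolynomial.induction_on with
  | C c => exact ⟨0, by simpa using hC c⟩
  | add p q hp hq =>
    obtain ⟨N, hN⟩ := hp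
    obtain ⟨M, hM⟩ := hq
    refine ⟨M + N, ?_⟩
    have h1 := RingHom.IsIntegralElem.mul φ (φ.isIntegralElem_map (x := h ^ M)) hN
    have h2 := RingHom.IsIntegralElem.mul φ (φ.isIntegralElem_map (x := h ^ N)) hM
    have h3 := RingHom.IsIntegralElem.add φ h1 h2
    have e : φ (h ^ (M + N)) * (p + q) =
        φ (h ^ M) * (φ (h ^ N) * p) + φ (h ^ N) * (φ (h ^ M) * q) := by
      rw [pow_add, map_mul]; ring
    rwa [e]
  | mul_X p i hp =>
    obtain ⟨N, hN⟩ := hp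
    obtain ⟨M, hM⟩ := hX i
    refine ⟨M + N, ?_⟩
    have h3 := RingHom.IsIntegralElem.mul φ hM hN
    have e : φ (h ^ (M + N)) * (p * X i) = φ (h ^ M) * X i * (φ (h ^ N) * p) := by
      rw [pow_add, map_mul]; ring
    rwa [e]

variable {K : Type*} [Field K] {n m : ℕ}

/-- The ideal of the polynomials `a` on the target such that `(a ∘ f) xᵢ` is integral over the
algebra generated by the components of `f`. -/
def coordinateDenominators (f : Fin m → MvPolynomial (Fin n) K) (i : Fin n) :
    Ideal (MvPolynomial (Fin m) K) :=
  denominatorIdeal (aeval f : MvPolynomial (Fin m) K →ₐ[K] MvPolynomial (Fin n) K).toRingHom (X i)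

theorem comorphism_comp_mk [Infinite K] (f : Fin m → MvPolynomial (Fin n) K) :
    (comorphism f).comp (Ideal.Quotient.mk _) =
      (aeval f : MvPolynomial (Fin m) K →ₐ[K] MvPolynomial (Fin n) K).toRingHom :=
  Ideal.Quotient.lift_comp_mk _ _ _

theorem evalAt_mk (f : Fin m → MvPolynomial (Fin n) K) (y : imageClosure f)
    (a : MvPolynomial (Fin m) K) : evalAt f y (Ideal.Quotient.mk _ a) = eval (y : Fin m → K) a :=
  rfl

/-- Properness at `y` only concerns the coordinate functions: each must become integral after
multiplication by a function on the target that does not vanish at `y`. -/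
theorem isProperAt_iff [Infinite K] (f : Fin m → MvPolynomial (Fin n) K) (y : imageClosure f) :
    IsProperAt f y ↔
      ∀ i, ∃ a ∈ coordinateDenominators f i, eval (y : Fin m → K) a ≠ 0 := by
  constructor
  · rintro ⟨U, hyU, -, -, hint⟩ i
    obtain ⟨h, hh, hx⟩ := exists_isIntegralElem_of_isIntegral_app _ U _ hyU hint
    obtain ⟨N, hN⟩ := hx (X i)
    obtain ⟨a, rfl⟩ := Ideal.Quotient.mk_surjective h
    refine ⟨a ^ N, ?_, ?_⟩
    · rw [coordinateDenominators, mem_denominatorIdeal, ← comorphism_comp_mk,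
        isIntegralElem_comp_iff_of_surjective _ Ideal.Quotient.mk_surjective]
      simpa using hN
    · have : evalAt f y (Ideal.Quotient.mk _ a) ≠ 0 := hh
      rw [evalAt_mk] at this
      rw [map_pow]
      exact pow_ne_zero _ this
  · intro H
    choose a ha hay using H
    -- One function that makes all coordinates integral.
    let b := ∏ i, a i
    let h : ImageCoordRing f := Ideal.Quotient.mk _ b
    have hb : eval (y : Fin m → K) b ≠ 0 := by
      rw [map_prod]
      exact Finset.prod_ne_zero_iff.2 fun i _ => hay i
    refine ⟨specBasicOpen h, show evalAt f y h ≠ 0 from hb, IsAffineOpen.Spec_basicOpen _,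
      ?_, ?_⟩
    · exact IsAffineOpen.Spec_basicOpen (R := .of (MvPolynomial (Fin n) K)) (comorphism f h)
    · refine isIntegral_app_basicOpen _ _ ?_
      refine exists_isIntegralElem_of_forall_X (comorphism f) (fun c => ?_) h fun i => ⟨1, ?_⟩
      · have := (comorphism f).isIntegralElem_map (x := Ideal.Quotient.mk _ (C c))
        have e : comorphism f (Ideal.Quotient.mk _ (C c)) = C c :=
          (DFunLike.congr_fun (comorphism_comp_mk f) (C c)).trans (by simp)
        rwa [e] at this
      · have : b ∈ coordinateDenominators f i :=
          Ideal.mem_of_dvd _ (Finset.dvd_prod_of_mem a (Finset.mem_univ i)) (ha i)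
        rw [coordinateDenominators, mem_denominatorIdeal, ← comorphism_comp_mk,
          isIntegralElem_comp_iff_of_surjective _ Ideal.Quotient.mk_surjective] at this
        simpa using this

theorem isClosed_iff_isAffineVariety {V : Set (Fin m → K)} : IsClosed V ↔ IsAffineVariety V :=
  by
  rw [← isOpen_compl_iff]
  change Vᶜᶜ ∈ {V : Set (Fin m → K) | IsAffineVariety V} ↔ _
  rw [compl_compl]; rfl

theorem isClosed_zeroLocus (I : Ideal (MvPolynomial (Fin m) K)) : IsClosed (zeroLocus K I) :=
  isClosed_iff_isAffineVariety.2 ⟨I, rfl⟩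

theorem zeroLocus_vanishingIdeal_of_isClosed {V : Set (Fin m → K)} (hV : IsClosed V) :
    zeroLocus K (vanishingIdeal K V) = V := by
  obtain ⟨I, rfl⟩ := isClosed_iff_isAffineVariety.1 hV
  exact (zeroLocus_anti_mono (le_vanishingIdeal_zeroLocus I)).antisymm
    (zeroLocus_vanishingIdeal_le _)

/-- The non-properness set is the union over the coordinates `xᵢ` of the zero loci of the ideals
`coordinateDenominators f i`, here written as the zero locus of their intersection. That it lies in
the closure of the image is automatic, as these ideals contain the kernel of `h ↦ h ∘ f`. -/
theorem nonProperSet_eq_zeroLocus [Infinite K] (f : Fin m → MvPolynomial (Fin n) K) :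
    nonProperSet f = zeroLocus K (Finset.univ.inf (coordinateDenominators f)) := by
  ext y
  constructor
  · rintro ⟨hy, hpr⟩
    rw [isProperAt_iff] at hpr
    push Not at hpr
    obtain ⟨i, hi⟩ := hpr
    intro a ha
    exact hi a ((Submodule.mem_finsetInf.1 ha) i (Finset.mem_univ i))
  · intro hy
    have hyY : y ∈ imageClosure f := by
      rw [imageClosure, ← zeroLocus_vanishingIdeal_of_isClosed isClosed_closure]
      intro p hp
      refine hy p ?_
      rw [Submodule.mem_finsetInf]
      intro i _
      have h0 : (aeval f : _ →ₐ[K] MvPolynomial (Fin n) K).toRingHom p = 0 :=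
        aeval_eq_zero_of_mem f p hp
      rw [coordinateDenominators, mem_denominatorIdeal, h0, zero_mul]
      exact RingHom.isIntegralElem_zero _
    refine ⟨hyY, fun hpr => ?_⟩
    rw [isProperAt_iff] at hpr
    choose a ha hay using hpr
    have hb : ∏ i, a i ∈ Finset.univ.inf (coordinateDenominators f) := by
      rw [Submodule.mem_finsetInf]
      exact fun i _ => Ideal.mem_of_dvd _ (Finset.dvd_prod_of_mem a (Finset.mem_univ i)) (ha i)
    have := hy _ hb
    rw [aeval_eq_eval] at this
    rw [map_prod] at this
    obtain ⟨i, -, hi⟩ := Finset.prod_eq_zero_iff.1 this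
    exact hay i hi

end

/-! ### Domination by valuation rings and rescaling of curves -/

section

/-- For a ring homomorphism `e : R → F` into a field and a prime `q` containing its kernel, some
valuation ring of `F` contains the image of `R` and has `q` as the preimage of its maximal ideal. -/
theorem exists_valuationSubring_of_ker_le {R F : Type*} [CommRing R] [Field F] (e : R →+* F)
    (q : Ideal R) [q.IsPrime] (h : RingHom.ker e ≤ q) :
    ∃ (O : ValuationSubring F) (e' : R →+* O), O.subtype.comp e' = e ∧
      ∀ r, residue O (e' r) = 0 ↔ r ∈ q := by
  have hu (s : q.primeCompl) : IsUnit (e s) := by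
    rw [isUnit_iff_ne_zero]
    exact fun h0 => s.2 (h h0)
  let g : Localization.AtPrime q →+* F := IsLocalization.lift hu
  obtain ⟨O, hO, hloc⟩ := IsLocalRing.exists_factor_valuationRing g
  let g' : Localization.AtPrime q →+* O := g.codRestrict O.toSubring hO
  have hg' : IsLocalHom g' := hloc
  refine ⟨O, g'.comp (algebraMap R _), ?_, fun r => ?_⟩
  · ext r
    exact IsLocalization.lift_eq hu r
  · rw [IsLocalRing.residue_eq_zero_iff, IsLocalRing.mem_maximalIdeal, mem_nonunits_iff,
      RingHom.comp_apply, isUnit_map_iff g', IsLocalization.AtPrime.isUnit_to_map_iff _ q,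
      Ideal.mem_primeCompl_iff, not_not]

/-- A ring homomorphism `a : R → F` into a field and an element `z ∈ F` such that
every polynomial relation of `z` over `R` has constant term in the prime `P`: then some valuation
ring of `F` dominates `R` at `P` and has `z` in its maximal ideal. -/
theorem exists_valuationSubring_of_coeff_zero_mem {R F : Type*} [CommRing R] [Field F]
    (a : R →+* F) (z : F) (P : Ideal R) [P.IsPrime]
    (h : ∀ q : Polynomial R, q.eval₂ a z = 0 → q.coeff 0 ∈ P) :
    ∃ (O : ValuationSubring F) (a' : R →+* O) (z' : O), O.subtype.comp a' = a ∧ (z' : F) = z ∧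
      (∀ r, residue O (a' r) = 0 ↔ r ∈ P) ∧ residue O z' = 0 := by
  obtain ⟨O, e', he', hq⟩ := exists_valuationSubring_of_ker_le (Polynomial.eval₂RingHom a z)
    -- The prime of `R[X]` generated by `P` and `X`.
    (P.comap Polynomial.constantCoeff) (fun q hq => h q hq)
  refine ⟨O, e'.comp Polynomial.C, e' Polynomial.X, ?_, ?_, fun r => ?_, ?_⟩
  · rw [← RingHom.comp_assoc, he']
    ext r; simp
  · have := DFunLike.congr_fun he' Polynomial.X
    simpa using this
  · rw [RingHom.comp_apply, hq]; simp
  · rw [hq]; simp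

/-- Rescaling the parameter makes a nonconstant polynomial curve over an algebraically closed
valued field, with integral starting point, reduce to a nonconstant curve over the residue
field. -/
theorem exists_rescaling {F ι : Type*} [Field F] [IsAlgClosed F] [Finite ι]
    (O : ValuationSubring F) (φ : ι → Polynomial F) (h0 : ∀ i, (φ i).coeff 0 ∈ O)
    (hφ : ∃ i, (φ i).natDegree ≠ 0) :
    ∃ (c : F) (ψ : ι → Polynomial O),
      (∀ i, (ψ i).map O.subtype = (φ i).comp (Polynomial.C c * Polynomial.X)) ∧
      ∃ i, ((ψ i).map (residue O)).natDegree ≠ 0 := by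
  classical
  have := Fintype.ofFinite ι
  -- The `(j + 1)`-st roots of the coefficients of degree `j + 1`.
  choose b hb using fun (i : ι) (j : ℕ) =>
    IsAlgClosed.exists_pow_nat_eq ((φ i).coeff (j + 1)) j.succ_pos
  obtain ⟨i₀, hi₀⟩ := hφ
  let S : Finset (Σ _ : ι, ℕ) := Finset.univ.sigma fun i => Finset.range (φ i).natDegree
  have hi₀S : (⟨i₀, (φ i₀).natDegree - 1⟩ : Σ _ : ι, ℕ) ∈ S := by
    simp only [S, Finset.mem_sigma, Finset.mem_univ, Finset.mem_range, true_and]; omega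
  obtain ⟨⟨i₁, j₁⟩, hmem, hmax⟩ := S.exists_max_image (fun s => O.valuation (b s.1 s.2)) ⟨_, hi₀S⟩
  have hne : O.valuation (b i₁ j₁) ≠ 0 := by
    refine (lt_of_lt_of_le ?_ (hmax _ hi₀S)).ne'
    rw [zero_lt_iff, Valuation.ne_zero_iff]
    rintro h
    have := hb i₀ ((φ i₀).natDegree - 1)
    simp only at h
    rw [h, zero_pow (Nat.succ_ne_zero _), Nat.sub_add_cancel (Nat.pos_of_ne_zero hi₀)] at this
    refine hi₀ ?_
    rw [Polynomial.leadingCoeff_eq_zero.1 this.symm, Polynomial.natDegree_zero]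
  have hbne : b i₁ j₁ ≠ 0 := (Valuation.ne_zero_iff _).1 hne
  -- Scaling by the inverse of the largest root makes all coefficients integral and one of them `1`.
  let c := (b i₁ j₁)⁻¹
  have hcoeff (i : ι) (j : ℕ) :
      ((φ i).comp (Polynomial.C c * Polynomial.X)).coeff (j + 1) = (b i j * c) ^ (j + 1) := by
    rw [Polynomial.comp_C_mul_X_coeff, mul_pow, hb]
  have hint (i : ι) (j : ℕ) : ((φ i).comp (Polynomial.C c * Polynomial.X)).coeff j ∈ O := by
    cases j with
    | zero => simpa [Polynomial.comp_C_mul_X_coeff] using h0 i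
    | succ j =>
      rw [hcoeff]
      refine pow_mem ?_ _
      rw [← ValuationSubring.valuation_le_one_iff, map_mul, map_inv₀]
      by_cases hj : j < (φ i).natDegree
      · exact mul_inv_le_one_of_le₀ (hmax ⟨i, j⟩ (by simp [S, hj])) zero_le
      · have : b i j = 0 := by
          have := hb i j
          rw [Polynomial.coeff_eq_zero_of_natDegree_lt (by omega)] at this
          exact pow_eq_zero_iff (Nat.succ_ne_zero _) |>.1 this
        simp [this]
  have hlift (i : ι) : ∃ q : Polynomial O,
      q.map O.subtype = (φ i).comp (Polynomial.C c * Polynomial.X) := by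
    rw [← Polynomial.mem_lifts, Polynomial.lifts_iff_coeff_lifts]
    exact fun j => ⟨⟨_, hint i j⟩, rfl⟩
  choose ψ hψ using hlift
  refine ⟨c, ψ, hψ, i₁, fun hdeg => ?_⟩
  have h1 : (ψ i₁).coeff (j₁ + 1) = 1 := by
    apply O.subtype_injective
    rw [← Polynomial.coeff_map, hψ, hcoeff, mul_inv_cancel₀ hbne, one_pow, map_one]
  have h2 : ((ψ i₁).map (residue O)).coeff (j₁ + 1) = 0 :=
    Polynomial.coeff_eq_zero_of_natDegree_lt (by omega)
  rw [Polynomial.coeff_map, h1, map_one] at h2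
  exact one_ne_zero h2

theorem natDegree_le_of_map_eq_comp {F : Type*} [Field F] (O : ValuationSubring F)
    {φ : Polynomial F} {ψ : Polynomial O} {c : F}
    (h : ψ.map O.subtype = φ.comp (Polynomial.C c * Polynomial.X)) :
    ψ.natDegree ≤ φ.natDegree := by
  rw [← Polynomial.natDegree_map_eq_of_injective O.subtype_injective ψ, h]
  refine Polynomial.natDegree_comp_le.trans ?_
  calc φ.natDegree * _ ≤ φ.natDegree * 1 :=
        Nat.mul_le_mul_left _ ((Polynomial.natDegree_C_mul_le _ _).trans Polynomial.natDegree_X_le)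
    _ = _ := mul_one _

/-- Substituting into a polynomial commutes with rescaling the parameter. -/
theorem map_aeval_eq_comp {K F σ : Type*} [Field K] [Field F] [Algebra K F]
    (O : ValuationSubring F) [Algebra K O] [IsScalarTower K O F] {φ : σ → Polynomial F}
    {ψ : σ → Polynomial O} {c : F}
    (h : ∀ i, (ψ i).map O.subtype = (φ i).comp (Polynomial.C c * Polynomial.X))
    (p : MvPolynomial σ K) :
    (aeval ψ p).map O.subtype = (aeval φ p).comp (Polynomial.C c * Polynomial.X) := by
  induction p using MvPolynomial.induction_on with
  | C r =>
    simp only [aeval_C, Polynomial.algebraMap_apply, Polynomial.map_C, Polynomial.C_comp]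
    exact congrArg Polynomial.C (IsScalarTower.algebraMap_apply K O F r).symm
  | add p q hp hq => simp [hp, hq]
  | mul_X p i hp => simp [hp, h]

theorem map_aeval {K L L' σ : Type*} [CommRing K] [CommRing L] [CommRing L'] [Algebra K L]
    [Algebra K L'] (g : L →ₐ[K] L') (φ : σ → Polynomial L) (p : MvPolynomial σ K) :
    aeval (fun i => (φ i).map g.toRingHom) p = (aeval φ p).map g.toRingHom := by
  have : aeval (fun i => (φ i).map g.toRingHom) = (Polynomial.mapAlgHom g).comp (aeval φ) := by
    ext; simp
  rw [this]
  rfl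

theorem aeval_coeff_zero {K L σ : Type*} [CommRing K] [CommRing L] [Algebra K L]
    (φ : σ → Polynomial L) (p : MvPolynomial σ K) :
    aeval (fun i => (φ i).coeff 0) p = (aeval φ p).coeff 0 := by
  induction p using MvPolynomial.induction_on with
  | C r => simp [Polynomial.algebraMap_apply]
  | add p q hp hq => simp [hp, hq]
  | mul_X p i hp => simp [hp, Polynomial.mul_coeff_zero]

end

/-! ### Limits of curves -/

section

variable {K : Type u} [Field K] {n m : ℕ}

/-- Restriction of a polynomial to the line through the generic point in the direction of the
`j`-th coordinate axis: the substitution `x ↦ x + s eⱼ`. -/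
def restrictLine (j : Fin n) :
    MvPolynomial (Fin n) K →ₐ[K] Polynomial (MvPolynomial (Fin n) K) :=
  aeval fun t => Polynomial.C (X t) + if t = j then Polynomial.X else 0

theorem coeff_zero_restrictLine (j : Fin n) (p : MvPolynomial (Fin n) K) :
    (restrictLine j p).coeff 0 = p := by
  rw [restrictLine, ← aeval_coeff_zero]
  convert! aeval_X_left_apply p with t
  simp [apply_ite (fun q : Polynomial (MvPolynomial (Fin n) K) => q.coeff 0)]

theorem natDegree_restrictLine_le (j : Fin n) (p : MvPolynomial (Fin n) K) :
    (restrictLine j p).natDegree ≤ p.totalDegree := by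
  rw [restrictLine, aeval_def, eval₂_eq]
  refine Polynomial.natDegree_sum_le_of_forall_le _ _ fun s hs => ?_
  refine (Polynomial.natDegree_mul_le).trans ?_
  have h1 : (algebraMap K (Polynomial (MvPolynomial (Fin n) K)) (coeff s p)).natDegree = 0 := by
    rw [Polynomial.algebraMap_apply, Polynomial.natDegree_C]
  rw [h1, zero_add]
  refine (Polynomial.natDegree_prod_le _ _).trans (le_trans ?_ (le_totalDegree hs))
  refine Finset.sum_le_sum fun t _ => ?_
  refine (Polynomial.natDegree_pow_le).trans ?_
  calc s t * _ ≤ s t * 1 := Nat.mul_le_mul_left _ ?_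
    _ = s t := mul_one _
  refine (Polynomial.natDegree_add_le _ _).trans ?_
  split_ifs <;> simp

/-- A relation `h(1/xᵢ) = 0` with coefficients in the algebra generated by the components of `f`,
multiplied by a power of `xᵢ`, has the constant term of `h` as its leading coefficient. -/
theorem coeff_zero_mem_coordinateDenominators (f : Fin m → MvPolynomial (Fin n) K) (i : Fin n)
    {F : Type*} [Field F] (ι : MvPolynomial (Fin n) K →+* F) (hι : Function.Injective ι)
    (q : Polynomial (MvPolynomial (Fin m) K))
    (hq : q.eval₂ (ι.comp (aeval f : _ →ₐ[K] MvPolynomial (Fin n) K).toRingHom) (ι (X i))⁻¹ = 0) :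
    q.coeff 0 ∈ coordinateDenominators f i := by
  by_cases h0 : q.coeff 0 = 0
  · rw [h0]; exact zero_mem _
  have hX : ι (X i) ≠ 0 := by
    rw [Ne, map_eq_zero_iff ι hι]; exact X_ne_zero i
  let _ : Invertible (ι (X i))⁻¹ := ⟨ι (X i), mul_inv_cancel₀ hX, inv_mul_cancel₀ hX⟩
  have h1 := Polynomial.eval₂_reverse_mul_pow
    (ι.comp (aeval f : _ →ₐ[K] MvPolynomial (Fin n) K).toRingHom) (ι (X i))⁻¹ q
  rw [hq] at h1
  have h2 := (mul_eq_zero.1 h1).resolve_right (pow_ne_zero _ (inv_ne_zero hX))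
  change q.reverse.eval₂ _ (ι (X i)) = 0 at h2
  rw [← Polynomial.hom_eval₂, map_eq_zero_iff ι hι] at h2
  have h3 := RingHom.isIntegralElem_leadingCoeff_mul _ _ _ h2
  rwa [Polynomial.reverse_leadingCoeff, Polynomial.trailingCoeff_eq_coeff_zero h0] at h3

/-- Let `1 / x` lie in the maximal ideal of `O`. If the product of a polynomial over `O` with the
constant `x` is integral over a ring of polynomials over `O`, then the polynomial reduces to zero:
divide the integral equation by the power of `x` in its leading term and reduce. -/
theorem map_residue_eq_zero_of_isIntegral {R F : Type*} [CommRing R] [Field F]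
    (O : ValuationSubring F) (Ψ : R →+* Polynomial O) (g : R) (x : F) (hx : x ≠ 0) (z : O)
    (hzx : (z : F) = x⁻¹) (hz : residue O z = 0)
    (h : ((Polynomial.mapRingHom O.subtype).comp Ψ).IsIntegralElem
      ((Ψ g).map O.subtype * Polynomial.C x)) : (Ψ g).map (residue O) = 0 := by
  obtain ⟨q, hq, hq0⟩ := h
  -- Scaling the roots of the equation by `z = 1 / x` divides it by that power of `x`; modulo the
  -- maximal ideal, where `z = 0`, only the leading term is left.
  set Q : Polynomial (Polynomial O) := q.map Ψ with hQ
  have hQm : Q.Monic := hq.map _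
  have hzx' : (Polynomial.mapRingHom O.subtype) (Polynomial.C z) = Polynomial.C x⁻¹ := by
    rw [← hzx]; simp
  have h1 : (Q.scaleRoots (Polynomial.C z)).eval₂ (Polynomial.mapRingHom O.subtype)
      ((Ψ g).map O.subtype) = 0 := by
    have e : (Ψ g).map O.subtype = (Polynomial.mapRingHom O.subtype) (Polynomial.C z) *
        ((Ψ g).map O.subtype * Polynomial.C x) := by
      rw [hzx', mul_left_comm, ← Polynomial.C_mul, inv_mul_cancel₀ hx, Polynomial.C_1, mul_one]
    rw [e, Polynomial.scaleRoots_eval₂_mul, hQ, Polynomial.eval₂_map, hq0, mul_zero]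
  have h2 : (Q.scaleRoots (Polynomial.C z)).eval (Ψ g) = 0 := by
    apply Polynomial.map_injective O.subtype O.subtype_injective
    rw [Polynomial.map_zero, ← h1, ← Polynomial.coe_mapRingHom, ← Polynomial.eval₂_at_apply]
  have h3 := congrArg (Polynomial.mapRingHom (residue O)) h2
  rw [map_zero, ← Polynomial.eval₂_at_apply, ← Polynomial.eval_map, Polynomial.map_scaleRoots _ _ _
    (by rw [hQm.leadingCoeff, map_one]; exact one_ne_zero)] at h3
  have h4 : (Polynomial.mapRingHom (residue O)) (Polynomial.C z) = 0 := by simp [hz]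
  rw [h4, Polynomial.scaleRoots_zero, (hQm.map _).leadingCoeff, one_smul, Polynomial.eval_pow,
    Polynomial.eval_X] at h3
  exact eq_zero_of_pow_eq_zero h3

/-- Let the prime `P` contain the ideal of denominators of `xᵢ`, and let `f` be nonconstant along the
lines in the direction of some other coordinate `xⱼ`. Then over some extension of `K` there is a
nonconstant curve of degree at most `d` that starts at the generic point of the zero locus of `P`
and satisfies the equations in the ideal of denominators. It is a limit of images of lines. -/
theorem exists_curve_of_coordinateDenominators_le (f : Fin m → MvPolynomial (Fin n) K)
    {d : ℕ} (hd : ∀ l, (f l).totalDegree ≤ d) (P : Ideal (MvPolynomial (Fin m) K)) [P.IsPrime]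
    {i j : Fin n} (hij : i ≠ j) (hP : coordinateDenominators f i ≤ P)
    (hj : ∃ l, (restrictLine j (f l)).natDegree ≠ 0) :
    ∃ (k : Type u) (_ : Field k) (_ : Algebra K k) (φ : Fin m → Polynomial k),
      (∀ l, (φ l).natDegree ≤ d) ∧ (∃ l, (φ l).natDegree ≠ 0) ∧
      (∀ p ∈ coordinateDenominators f i, aeval φ p = 0) ∧
      ∀ p, aeval (fun l => (φ l).coeff 0) p = 0 ↔ p ∈ P := by
  let B := MvPolynomial (Fin n) K
  let F := AlgebraicClosure (FractionRing B)
  let ι : B →ₐ[K] F := (IsScalarTower.toAlgHom K (FractionRing B) F).comp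
    (IsScalarTower.toAlgHom K B (FractionRing B))
  have hι : Function.Injective ι := 
    (algebraMap (FractionRing B) F).injective.comp (IsFractionRing.injective B (FractionRing B))
  -- The valuation ring dominates the algebra generated by the components of `f` at `P`, and `1 / xᵢ`
  -- lies in its maximal ideal.
  obtain ⟨O, a', z, ha', hz, haP, hz0⟩ := exists_valuationSubring_of_coeff_zero_mem
    (ι.toRingHom.comp (aeval f : _ →ₐ[K] B).toRingHom) (ι (X i))⁻¹ P
    (fun q hq => hP (coeff_zero_mem_coordinateDenominators f i ι.toRingHom hι q hq))
  have ha'' (p) : (a' p : F) = ι (aeval f p) := DFunLike.congr_fun ha' p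
  let _ : Algebra K O := (a'.comp C).toAlgebra
  have : IsScalarTower K O F := .of_algebraMap_eq fun c => by
    refine Eq.trans ?_ (ha'' (C c)).symm
    rw [← algebraMap_eq, AlgHom.commutes]
    exact (ι.commutes c).symm
  let φ : Fin m → Polynomial F := fun l => (restrictLine j (f l)).map ι.toRingHom
  have hφ0 (l) : (φ l).coeff 0 = (a' (X l) : F) := by
    rw [ha'', aeval_X, Polynomial.coeff_map, coeff_zero_restrictLine]
    rfl
  have hφdeg (l) : (φ l).natDegree = (restrictLine j (f l)).natDegree :=
    Polynomial.natDegree_map_eq_of_injective hι _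
  have hφaeval (p : MvPolynomial (Fin m) K) :
      aeval φ p = (restrictLine j (aeval f p)).map ι.toRingHom := by
    rw [map_aeval]
    congr 1
    rw [← AlgHom.comp_apply, comp_aeval]
  obtain ⟨c, ψ, hψ, hne⟩ := exists_rescaling O φ (fun l => by rw [hφ0]; exact (a' (X l)).2)
    (by simpa only [hφdeg] using hj)
  let ρ : O →ₐ[K] ResidueField O := IsScalarTower.toAlgHom K O (ResidueField O)
  have hρ : ρ.toRingHom = residue O := rfl
  refine ⟨ResidueField O, inferInstance, inferInstance, fun l => (ψ l).map ρ.toRingHom,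
    fun l => ?_, hne, fun p hp => ?_, fun p => ?_⟩
  · refine Polynomial.natDegree_map_le.trans ?_
    refine (natDegree_le_of_map_eq_comp O (hψ l)).trans ?_
    rw [hφdeg]
    exact (natDegree_restrictLine_le j _).trans (hd l)
  · rw [map_aeval]
    have hX : ι (X i) ≠ 0 := by
      rw [Ne, map_eq_zero_iff ι hι]; exact X_ne_zero i
    refine map_residue_eq_zero_of_isIntegral O (aeval ψ : _ →ₐ[K] Polynomial O).toRingHom p _ hX z
      hz hz0 ?_
    -- The substitution `x ↦ x + c s eⱼ` turns the integral equation of `p(f) xᵢ` into one over the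
    -- valuation ring, and fixes `xᵢ` because `i ≠ j`.
    let θ : B →+* Polynomial F := (Polynomial.compRingHom (Polynomial.C c * Polynomial.X)).comp
      ((Polynomial.mapRingHom ι.toRingHom).comp (restrictLine j).toRingHom)
    have hθ (p : MvPolynomial (Fin m) K) : θ (aeval f p) = (aeval ψ p).map O.subtype := by
      rw [map_aeval_eq_comp O hψ, hφaeval]
      rfl
    have hθX : θ (X i) = Polynomial.C (ι (X i)) := by
      have h1 : restrictLine j (X i : B) = Polynomial.C (X i) := by
        rw [restrictLine]
        exact (aeval_X _ i).trans (by rw [if_neg hij, add_zero])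
      simp only [θ, RingHom.comp_apply, AlgHom.toRingHom_eq_coe, RingHom.coe_coe, h1,
        Polynomial.coe_mapRingHom, Polynomial.map_C, Polynomial.coe_compRingHom,
        Polynomial.C_comp]
    obtain ⟨q, hq, hq0⟩ := hp
    refine ⟨q, hq, ?_⟩
    have h1 := congrArg θ hq0
    rw [map_zero, Polynomial.hom_eval₂, map_mul, hθX] at h1
    rw [← h1]
    have e : (Polynomial.mapRingHom O.subtype).comp (aeval ψ : _ →ₐ[K] Polynomial O).toRingHom =
        θ.comp (aeval f : _ →ₐ[K] B).toRingHom := RingHom.ext fun p => (hθ p).symm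
    rw [e]
    congr 2
    exact (hθ p).symm
  -- The limit starts at the residues of the components of `f`.
  · have hψ0 (l) : (ψ l).coeff 0 = a' (X l) := by
      apply O.subtype_injective
      rw [← Polynomial.coeff_map, hψ, Polynomial.comp_C_mul_X_coeff, pow_zero, mul_one, hφ0]
      rfl
    have e : (aeval (fun l => ((ψ l).map ρ.toRingHom).coeff 0) : _ →ₐ[K] ResidueField O).toRingHom =
        (residue O).comp a' := by
      refine MvPolynomial.ringHom_ext (fun c => ?_) fun l => ?_
      · simp
        rfl
      · simp only [Polynomial.coeff_map, hψ0, hρ, RingHom.comp_apply]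
        simp
    rw [← haP]
    exact iff_of_eq (congrArg (· = 0) (DFunLike.congr_fun e p))

/-- A curve through a point specialises to a curve through any specialisation `x` of the point, over
another extension of `K`: reduce a rescaled curve modulo a valuation ring dominating the local ring
at `x`. -/
theorem exists_curve_through_specialization {k : Type u} [Field k] [Algebra K k] {d : ℕ}
    (φ : Fin m → Polynomial k) (hd : ∀ l, (φ l).natDegree ≤ d) (hne : ∃ l, (φ l).natDegree ≠ 0)
    (x : Fin m → K) (hx : ∀ p : MvPolynomial (Fin m) K,
      aeval (fun l => (φ l).coeff 0) p = 0 → eval x p = 0) :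
    ∃ (k' : Type u) (_ : Field k') (_ : Algebra K k') (φ' : Fin m → Polynomial k'),
      (∀ l, (φ' l).natDegree ≤ d) ∧ (∃ l, (φ' l).natDegree ≠ 0) ∧
      (∀ l, (φ' l).coeff 0 = algebraMap K k' (x l)) ∧
      ∀ p : MvPolynomial (Fin m) K, aeval φ p = 0 → aeval φ' p = 0 := by
  let F := AlgebraicClosure k
  let ι : k →ₐ[K] F := IsScalarTower.toAlgHom K k F
  let a : MvPolynomial (Fin m) K →ₐ[K] F := ι.comp (aeval fun l => (φ l).coeff 0)
  have hprime := RingHom.ker_isPrime (eval x)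
  obtain ⟨O, a', ha', haP⟩ := exists_valuationSubring_of_ker_le a.toRingHom (RingHom.ker (eval x))
    (fun p hp => hx p ((map_eq_zero_iff ι ι.injective).1 hp))
  have ha'' (p) : (a' p : F) = a p := DFunLike.congr_fun ha' p
  let _ : Algebra K O := (a'.comp C).toAlgebra
  have : IsScalarTower K O F := .of_algebraMap_eq fun c => by
    refine Eq.trans ?_ (ha'' (C c)).symm
    simp [a]
  have hφ0 (l) : ((φ l).map ι.toRingHom).coeff 0 = (a' (X l) : F) := by
    simp [Polynomial.coeff_map, ha'', a]
  have hφdeg (l) : ((φ l).map ι.toRingHom).natDegree = (φ l).natDegree :=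
    Polynomial.natDegree_map_eq_of_injective ι.injective _
  obtain ⟨c, ψ, hψ, hne'⟩ := exists_rescaling O (fun l => (φ l).map ι.toRingHom)
    (fun l => by rw [hφ0]; exact (a' (X l)).2) (by simpa only [hφdeg] using hne)
  let ρ : O →ₐ[K] ResidueField O := IsScalarTower.toAlgHom K O (ResidueField O)
  have hρ : ρ.toRingHom = residue O := rfl
  refine ⟨ResidueField O, inferInstance, inferInstance, fun l => (ψ l).map ρ.toRingHom,
    fun l => ?_, hne', fun l => ?_, fun p hp => ?_⟩
  · refine Polynomial.natDegree_map_le.trans ?_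
    refine (natDegree_le_of_map_eq_comp O (hψ l)).trans ?_
    rw [hφdeg]
    exact hd l
  · have hψ0 : (ψ l).coeff 0 = a' (X l) := by
      apply O.subtype_injective
      rw [← Polynomial.coeff_map, hψ, Polynomial.comp_C_mul_X_coeff, pow_zero, mul_one, hφ0]
      rfl
    have h1 : residue O (a' (X l - C (x l))) = 0 := (haP _).2 (by simp [RingHom.mem_ker])
    rw [map_sub, map_sub, sub_eq_zero] at h1
    rw [Polynomial.coeff_map, hψ0, hρ, h1]
    rfl
  · have h1 : aeval ψ p = 0 := by
      apply Polynomial.map_injective O.subtype O.subtype_injective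
      rw [map_aeval_eq_comp O hψ, map_aeval, hp]
      simp
    rw [map_aeval, h1, Polynomial.map_zero]

end

/-! ### Specialisation to the base field -/

section

/-- An algebra of finite type over an algebraically closed field has a rational point. -/
theorem nonempty_algHom_of_finiteType (K T : Type*) [Field K] [IsAlgClosed K] [CommRing T]
    [Nontrivial T] [Algebra K T] [Algebra.FiniteType K T] : Nonempty (T →ₐ[K] K) := by
  obtain ⟨M, hM⟩ := Ideal.exists_maximal T
  let _ := Ideal.Quotient.field M
  have : Module.Finite K (T ⧸ M) := finite_of_finite_type_of_isJacobsonRing K (T ⧸ M)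
  exact ⟨(IsAlgClosed.lift : (T ⧸ M) →ₐ[K] K).comp (Ideal.Quotient.mkₐ K M)⟩

/-- A nonconstant polynomial curve over an extension of the algebraically closed field `K`
specialises to one over `K`, which still satisfies the equations over `K` of the former and has the
same starting point. -/
theorem exists_curve_over_base {K k ι : Type*} [Field K] [IsAlgClosed K] [Field k] [Algebra K k]
    [Finite ι] (φ : ι → Polynomial k) (hne : ∃ l, (φ l).natDegree ≠ 0) (x : ι → K)
    (hx : ∀ l, (φ l).coeff 0 = algebraMap K k (x l)) :
    ∃ φ' : ι → Polynomial K, (∀ l, (φ' l).natDegree ≤ (φ l).natDegree) ∧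
      (∃ l, (φ' l).natDegree ≠ 0) ∧ (∀ l, (φ' l).coeff 0 = x l) ∧
      ∀ p : MvPolynomial ι K, aeval φ p = 0 → aeval φ' p = 0 := by
  classical
  have := Fintype.ofFinite ι
  obtain ⟨l₀, hl₀⟩ := hne
  -- The coefficients, and an inverse of one of positive degree to keep the curve nonconstant,
  -- generate an algebra of finite type, which has a `K`-rational point `σ`.
  let s : Finset k := insert (φ l₀).leadingCoeff⁻¹ (Finset.univ.biUnion fun l => (φ l).coeffs)
  let T := Algebra.adjoin K (s : Set k)
  have hT : Algebra.FiniteType K T :=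
    (Subalgebra.fg_iff_finiteType T).1 (Subalgebra.fg_adjoin_finset s)
  have hinv : (φ l₀).leadingCoeff⁻¹ ∈ T :=
    Algebra.subset_adjoin (Finset.mem_coe.2 (Finset.mem_insert_self _ _))
  have hcoeff (l : ι) (j : ℕ) : (φ l).coeff j ∈ T := by
    by_cases h : (φ l).coeff j = 0
    · rw [h]; exact zero_mem T
    · refine Algebra.subset_adjoin (Finset.mem_coe.2 (Finset.mem_insert_of_mem ?_))
      exact Finset.mem_biUnion.2 ⟨l, Finset.mem_univ l, Polynomial.coeff_mem_coeffs h⟩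
  have hlift (l : ι) : ∃ q : Polynomial T, q.map T.val.toRingHom = φ l := by
    rw [← Polynomial.mem_lifts, Polynomial.lifts_iff_coeff_lifts]
    exact fun j => ⟨⟨_, hcoeff l j⟩, rfl⟩
  choose ψ hψ using hlift
  have hval : Function.Injective T.val.toRingHom := Subtype.val_injective
  obtain ⟨σ⟩ := nonempty_algHom_of_finiteType K T
  refine ⟨fun l => (ψ l).map σ.toRingHom, fun l => ?_, ⟨l₀, fun h0 => ?_⟩, fun l => ?_,
    fun p hp => ?_⟩
  · rw [← hψ, Polynomial.natDegree_map_eq_of_injective hval]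
    exact Polynomial.natDegree_map_le
  · have h1 : ((ψ l₀).map σ.toRingHom).coeff (φ l₀).natDegree = 0 :=
      Polynomial.coeff_eq_zero_of_natDegree_lt (by simp only at h0; omega)
    have h2 : (ψ l₀).coeff (φ l₀).natDegree * ⟨_, hinv⟩ = 1 := by
      apply hval
      rw [map_mul, ← Polynomial.coeff_map, hψ, map_one]
      refine mul_inv_cancel₀ ?_
      change (φ l₀).leadingCoeff ≠ 0
      rw [Ne, Polynomial.leadingCoeff_eq_zero]
      intro h
      simp [h] at hl₀
    have h3 := congrArg σ h2
    rw [map_mul, map_one] at h3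
    rw [Polynomial.coeff_map] at h1
    have h4 : σ ((ψ l₀).coeff (φ l₀).natDegree) = 0 := h1
    rw [h4, zero_mul] at h3
    exact zero_ne_one h3
  · have h1 : (ψ l).coeff 0 = algebraMap K T (x l) := by
      apply hval
      rw [← Polynomial.coeff_map, hψ, hx]
      rfl
    rw [Polynomial.coeff_map, h1]
    exact σ.commutes (x l)
  · have h1 : aeval ψ p = 0 := by
      apply Polynomial.map_injective _ hval
      rw [← map_aeval, Polynomial.map_zero, ← hp]
      congr 2
      exact funext hψ
    rw [map_aeval, h1, Polynomial.map_zero]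

end

/-! ### Polynomial curves and the Zariski topology -/

section

variable {K : Type*} [Field K] {m : ℕ}

/-- The Zariski closure of `V` is cut out by the polynomials that vanish on `V`. -/
theorem mem_closure_iff_forall {V : Set (Fin m → K)} {x : Fin m → K} :
    x ∈ closure V ↔ ∀ p : MvPolynomial (Fin m) K, (∀ v ∈ V, eval v p = 0) → eval x p = 0 := by
  constructor
  · intro hx p hp
    have h1 : closure V ⊆ zeroLocus K (Ideal.span {p}) :=
      closure_minimal (fun v hv => by rw [zeroLocus_span]; simpa [aeval_eq_eval] using hp v hv)
        (isClosed_zeroLocus _)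
    have := h1 hx p (Ideal.mem_span_singleton_self p)
    rwa [aeval_eq_eval] at this
  · intro h
    rw [← zeroLocus_vanishingIdeal_of_isClosed (isClosed_closure (s := V))]
    intro p hp
    rw [aeval_eq_eval]
    refine h p fun v hv => ?_
    have := hp v (subset_closure hv)
    rwa [aeval_eq_eval] at this

/-- The parametrisation `K → K^m` with polynomial components `φ`. -/
def paramMap (φ : Fin m → Polynomial K) (t : K) : Fin m → K := fun i => (φ i).eval t

theorem eval_paramMap (φ : Fin m → Polynomial K) (t : K) (p : MvPolynomial (Fin m) K) :
    eval (paramMap φ t) p = (aeval φ p : Polynomial K).eval t := by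
  induction p using MvPolynomial.induction_on with
  | C r => simp
  | add p q hp hq => simp [hp, hq]
  | mul_X p i hp => simp [hp, paramMap]

theorem isClosed_singleton_point (x : Fin m → K) : IsClosed ({x} : Set (Fin m → K)) := by
  rw [← closure_subset_iff_isClosed]
  intro y hy
  rw [mem_closure_iff_forall] at hy
  funext i
  have := hy (X i - C (x i)) (by simp)
  simpa [sub_eq_zero] using this

theorem t1Space_zariski : T1Space (Fin m → K) := ⟨isClosed_singleton_point⟩

theorem isIrreducible_of_isPrime_vanishingIdeal {V : Set (Fin m → K)}
    (h : (vanishingIdeal K V).IsPrime) : IsIrreducible V := by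
  refine ⟨?_, isPreirreducible_iff_isClosed_union_isClosed.2 fun V₁ V₂ h₁ h₂ hV => ?_⟩
  · rw [Set.nonempty_iff_ne_empty]
    rintro rfl
    exact h.ne_top vanishingIdeal_empty
  · by_contra! hcon
    rw [← zeroLocus_vanishingIdeal_of_isClosed h₁,
      ← zeroLocus_vanishingIdeal_of_isClosed h₂] at hcon
    obtain ⟨hc₁, hc₂⟩ := hcon
    have h₁' := mt (le_zeroLocus_iff_le_vanishingIdeal (K := K)).2 hc₁
    have h₂' := mt (le_zeroLocus_iff_le_vanishingIdeal (K := K)).2 hc₂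
    obtain ⟨p, hp, hpV⟩ := SetLike.not_le_iff_exists.1 h₁'
    obtain ⟨q, hq, hqV⟩ := SetLike.not_le_iff_exists.1 h₂'
    refine (h.mem_or_mem (x := p) (y := q) fun v hv => ?_).elim hpV hqV
    rw [map_mul]
    rcases hV hv with hv | hv
    · rw [hp v hv, zero_mul]
    · rw [hq v hv, mul_zero]

theorem isPrime_vanishingIdeal_of_isIrreducible {V : Set (Fin m → K)} (h : IsIrreducible V) :
    (vanishingIdeal K V).IsPrime := by
  refine ⟨fun htop => ?_, fun {p q} hpq => ?_⟩
  · obtain ⟨v, hv⟩ := h.nonempty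
    have : (1 : MvPolynomial (Fin m) K) ∈ vanishingIdeal K V := htop ▸ Submodule.mem_top
    have := this v hv
    rw [map_one] at this
    exact one_ne_zero this
  · have := isPreirreducible_iff_isClosed_union_isClosed.1 h.isPreirreducible
      (zeroLocus K (Ideal.span {p})) (zeroLocus K (Ideal.span {q})) (isClosed_zeroLocus _)
      (isClosed_zeroLocus _) fun v hv => by
        have := hpq v hv
        rw [map_mul, mul_eq_zero] at this
        simpa only [zeroLocus_span, Set.mem_singleton_iff, forall_eq, Set.mem_union,
          Set.mem_ofPred_eq] using this
    simp only [zeroLocus_span, Set.mem_singleton_iff, forall_eq] at this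
    exact this

/-- If a nonconstant polynomial in `x` with coefficients in `K` lies in the image of `φ`, then `x`
is integral over the source of `φ`. -/
theorem isIntegralElem_of_aeval_eq {R S : Type*} [CommRing R] [CommRing S] [Algebra K R]
    [Algebra K S] (φ : R →ₐ[K] S) (p : Polynomial K) (hp : p.natDegree ≠ 0) (x : S) (r : R)
    (h : Polynomial.aeval x p = φ r) : φ.toRingHom.IsIntegralElem x := by
  by_cases hR : Nontrivial R
  swap
  · rw [not_nontrivial_iff_subsingleton] at hR
    have : Subsingleton S := ⟨fun a b => by
      rw [← one_mul a, ← one_mul b, ← map_one φ, Subsingleton.elim (1 : R) 0]; simp⟩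
    exact ⟨0, Subsingleton.elim _ _, Subsingleton.elim _ _⟩
  have hp0 : p.leadingCoeff ≠ 0 := by
    rw [Ne, Polynomial.leadingCoeff_eq_zero]
    rintro rfl
    exact hp rfl
  let q : Polynomial R := p.map (algebraMap K R) - Polynomial.C r
  have hφK : φ.toRingHom.comp (algebraMap K R) = algebraMap K S := φ.comp_algebraMap
  have hq : q.eval₂ φ.toRingHom x = 0 := by
    rw [Polynomial.eval₂_sub, Polynomial.eval₂_map, Polynomial.eval₂_C, hφK, sub_eq_zero]
    exact h
  have hlc : q.leadingCoeff = algebraMap K R p.leadingCoeff := by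
    rw [Polynomial.leadingCoeff, Polynomial.natDegree_sub_C,
      Polynomial.natDegree_map_eq_of_injective (algebraMap K R).injective, Polynomial.coeff_sub,
      Polynomial.coeff_C_of_ne_zero hp, sub_zero, Polynomial.coeff_map]
    rfl
  have h1 := RingHom.isIntegralElem_leadingCoeff_mul _ q x hq
  have h2 := RingHom.IsIntegralElem.mul φ.toRingHom
    (φ.toRingHom.isIntegralElem_map (x := algebraMap K R p.leadingCoeff⁻¹)) h1
  rwa [hlc, ← mul_assoc, ← map_mul, ← map_mul, inv_mul_cancel₀ hp0, map_one, map_one, one_mul] at h2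

theorem vanishingIdeal_range_paramMap [Infinite K] (φ : Fin m → Polynomial K) :
    vanishingIdeal K (Set.range (paramMap φ)) =
      RingHom.ker (aeval φ : MvPolynomial (Fin m) K →ₐ[K] Polynomial K) := by
  ext p
  rw [mem_vanishingIdeal_iff, Set.forall_mem_range, RingHom.mem_ker]
  simp only [aeval_eq_eval]
  constructor
  · intro h
    refine Polynomial.funext fun t => ?_
    rw [← eval_paramMap, Polynomial.eval_zero]
    exact h t
  · intro h t
    exact (eval_paramMap φ t p).trans (by rw [h, Polynomial.eval_zero])

/-- A nonconstant polynomial map from the line is finite, so its image is closed. -/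
theorem isClosed_range_paramMap [IsAlgClosed K] (φ : Fin m → Polynomial K)
    (hne : ∃ i, (φ i).natDegree ≠ 0) : IsClosed (Set.range (paramMap φ)) := by
  obtain ⟨i, hi⟩ := hne
  rw [← closure_subset_iff_isClosed]
  intro y hy
  let Φ : MvPolynomial (Fin m) K →ₐ[K] Polynomial K := aeval φ
  -- `K[t]` is integral over the coordinate ring of the curve, so a prime of `K[t]` lies over the
  -- maximal ideal of `y`; a common root of its elements is a parameter of `y`.
  let _ : Algebra (MvPolynomial (Fin m) K) (Polynomial K) := Φ.toRingHom.toAlgebra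
  have hX : Φ.toRingHom.IsIntegralElem Polynomial.X :=
    isIntegralElem_of_aeval_eq Φ (φ i) hi _ (X i) (by simp [Φ])
  have hint : Algebra.IsIntegral (MvPolynomial (Fin m) K) (Polynomial K) := ⟨fun q => by
    change Φ.toRingHom.IsIntegralElem q
    have hC (c : K) : Φ.toRingHom.IsIntegralElem (Polynomial.C c) := by
      have := Φ.toRingHom.isIntegralElem_map (x := C c)
      simpa [Φ] using this
    induction q using Polynomial.induction_on with
    | C c => exact hC c
    | add p q hp hq => exact RingHom.IsIntegralElem.add _ hp hq
    | monomial k c h =>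
      rw [pow_succ, ← mul_assoc]
      exact RingHom.IsIntegralElem.mul _ h hX⟩
  have hprime := RingHom.ker_isPrime (eval y)
  obtain ⟨Q, hQ, hQy⟩ := Ideal.exists_ideal_over_prime_of_isIntegral_of_isDomain
    (S := Polynomial K) (RingHom.ker (eval y)) fun p hp => by
      refine mem_closure_iff_forall.1 hy p ?_
      have h1 : p ∈ vanishingIdeal K (Set.range (paramMap φ)) := by
        rw [vanishingIdeal_range_paramMap]; exact hp
      intro v hv
      have := h1 v hv
      rwa [aeval_eq_eval] at this
  have hmem (l) : φ l - Polynomial.C (y l) ∈ Q := by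
    have h1 : X l - C (y l) ∈ RingHom.ker (eval y) := by simp [RingHom.mem_ker]
    rw [← hQy, Ideal.mem_comap] at h1
    have h2 : algebraMap (MvPolynomial (Fin m) K) (Polynomial K) (X l - C (y l)) =
        φ l - Polynomial.C (y l) := by
      change Φ (X l - C (y l)) = _
      simp [Φ]
    rwa [h2] at h1
  obtain ⟨g, hg⟩ := (IsPrincipalIdealRing.principal Q).principal
  have hg' : Q = Ideal.span {g} := hg
  have hdvd (l) : g ∣ φ l - Polynomial.C (y l) := by
    rw [← Ideal.mem_span_singleton, ← hg']; exact hmem l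
  have hg0 : g ≠ 0 := by
    rintro rfl
    have := zero_dvd_iff.1 (hdvd i)
    rw [sub_eq_zero] at this
    rw [this, Polynomial.natDegree_C] at hi
    exact hi rfl
  have hgdeg : g.degree ≠ 0 := fun h => by
    have h1 : IsUnit g := Polynomial.isUnit_iff_degree_eq_zero.2 h
    exact hQ.ne_top (by rw [hg', Ideal.span_singleton_eq_top]; exact h1)
  obtain ⟨t, ht⟩ := IsAlgClosed.exists_root g hgdeg
  refine ⟨t, funext fun l => ?_⟩
  obtain ⟨b, hb⟩ := hdvd l
  have h1 := congrArg (Polynomial.eval t) hb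
  rw [Polynomial.eval_mul, ht.eq_zero, zero_mul, Polynomial.eval_sub, Polynomial.eval_C,
    sub_eq_zero] at h1
  exact h1

theorem isIrreducible_range_paramMap [Infinite K] (φ : Fin m → Polynomial K) :
    IsIrreducible (Set.range (paramMap φ)) :=
  isIrreducible_of_isPrime_vanishingIdeal <| by
    rw [vanishingIdeal_range_paramMap]
    exact RingHom.ker_isPrime _

/-- A closed set that does not contain the image of a polynomial curve meets it in finitely many
points. -/
theorem finite_range_paramMap_inter (φ : Fin m → Polynomial K) {W : Set (Fin m → K)}
    (hW : IsClosed W) (h : ¬ Set.range (paramMap φ) ⊆ W) :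
    (Set.range (paramMap φ) ∩ W).Finite := by
  classical
  obtain ⟨_, ⟨t, rfl⟩, ht⟩ := Set.not_subset.1 h
  rw [← zeroLocus_vanishingIdeal_of_isClosed hW, mem_zeroLocus_iff] at ht
  push Not at ht
  obtain ⟨p, hp, hpt⟩ := ht
  rw [aeval_eq_eval] at hpt
  have hp0 : (aeval φ p : Polynomial K) ≠ 0 := fun h0 => hpt <|
    (eval_paramMap φ t p).trans (by rw [h0, Polynomial.eval_zero])
  refine ((aeval φ p : Polynomial K).roots.toFinset.finite_toSet.image (paramMap φ)).subset ?_
  rintro _ ⟨⟨s, rfl⟩, hs⟩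
  refine ⟨s, ?_, rfl⟩
  have := hp _ hs
  rw [aeval_eq_eval] at this
  simpa [hp0, ← eval_paramMap] using this

/-- A proper irreducible closed subset of the curve is finite, hence a point. -/
theorem topologicalKrullDim_range_paramMap [IsAlgClosed K] (φ : Fin m → Polynomial K)
    (hne : ∃ i, (φ i).natDegree ≠ 0) : topologicalKrullDim (Set.range (paramMap φ)) = 1 := by
  have : T1Space (Fin m → K) := t1Space_zariski
  refine le_antisymm ?_ ?_
  · refine Order.krullDim_le_one_iff.2 fun Z => ?_
    by_cases hZ : (Z : Set (Set.range (paramMap φ))) = Set.univ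
    · refine Or.inr fun Z' _ => ?_
      intro x _
      have : x ∈ (Z : Set (Set.range (paramMap φ))) := hZ ▸ Set.mem_univ x
      exact this
    · refine Or.inl fun Z' hle x hx => ?_
      obtain ⟨W, hW, hWZ⟩ := isClosed_induced_iff.1 Z.isClosed'
      have hfin : (Z : Set (Set.range (paramMap φ))).Finite := by
        refine Set.Finite.of_finite_image (f := Subtype.val)
          ((finite_range_paramMap_inter φ hW fun hsub => hZ ?_).subset ?_)
          Subtype.val_injective.injOn
        · rw [Set.eq_univ_iff_forall]
          intro v
          change v ∈ Z.carrier
          rw [← hWZ]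
          exact hsub v.2
        · rintro _ ⟨v, hv, rfl⟩
          refine ⟨v.2, ?_⟩
          change v ∈ Z.carrier at hv
          rw [← hWZ] at hv
          exact hv
      have hsub : (Z : Set (Set.range (paramMap φ))).Subsingleton :=
        hfin.isDiscrete.subsingleton_of_isPreirreducible Z.isIrreducible'.isPreirreducible
      obtain ⟨z, hz⟩ := Z'.isIrreducible'.nonempty
      rw [hsub hx (hle hz)]
      exact hz
  · refine Order.one_le_krullDim_iff.2 ?_
    have hirr : IrreducibleSpace (Set.range (paramMap φ)) :=
      isIrreducible_iff_irreducibleSpace.1 (isIrreducible_range_paramMap φ)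
    let x : Set.range (paramMap φ) := ⟨paramMap φ 0, 0, rfl⟩
    let Z : TopologicalSpace.IrreducibleCloseds (Set.range (paramMap φ)) :=
      ⟨{x}, isIrreducible_singleton, isClosed_singleton⟩
    let T : TopologicalSpace.IrreducibleCloseds (Set.range (paramMap φ)) :=
      ⟨Set.univ, IrreducibleSpace.isIrreducible_univ _, isClosed_univ⟩
    refine ⟨Z, T, lt_of_le_not_ge (fun _ _ => Set.mem_univ _) fun hle => ?_⟩
    obtain ⟨i, hi⟩ := hne
    refine hi ?_
    have hconst : φ i = Polynomial.C ((φ i).eval 0) := Polynomial.funext fun t => by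
      have h1 : (⟨paramMap φ t, t, rfl⟩ : Set.range (paramMap φ)) ∈ Z := hle (Set.mem_univ _)
      have h2 : paramMap φ t = paramMap φ 0 := congrArg Subtype.val (Set.mem_singleton_iff.1 h1)
      rw [Polynomial.eval_C]
      exact congrFun h2 i
    rw [hconst, Polynomial.natDegree_C]

theorem isParametricCurve_range [IsAlgClosed K] {d : ℕ} (φ : Fin m → Polynomial K)
    (hd : ∀ i, (φ i).natDegree ≤ d) (hne : ∃ i, (φ i).natDegree ≠ 0) :
    IsParametricCurve d (Set.range (paramMap φ)) :=
  have hcl := isClosed_range_paramMap φ hne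
  ⟨⟨isClosed_iff_isAffineVariety.1 hcl, topologicalKrullDim_range_paramMap φ hne⟩, φ, hd,
    hcl.closure_eq⟩

end

/-! ### Uniruledness of the non-properness set -/

section

variable {K : Type*} [Field K] {n m : ℕ}

theorem eval₂_restrictLine (j : Fin n) (x : Fin n → K) (s : K) (p : MvPolynomial (Fin n) K) :
    (restrictLine j p).eval₂ (eval x) s = eval (x + Pi.single j s) p := by
  have h : (Polynomial.eval₂RingHom (eval x) s).comp (restrictLine j).toRingHom =
      eval (x + Pi.single j s) := by
    refine MvPolynomial.ringHom_ext (fun c => ?_) fun t => ?_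
    · simp [restrictLine, Polynomial.algebraMap_apply]
    · by_cases ht : t = j
      · subst ht; simp [restrictLine]
      · simp [restrictLine, ht]
  exact DFunLike.congr_fun h p

/-- A generically finite polynomial map is nonconstant in every coordinate direction, because
otherwise all its fibres would be unions of lines. -/
theorem IsGenericallyFinite.exists_natDegree_restrictLine_ne_zero [Infinite K]
    {f : Fin m → MvPolynomial (Fin n) K} (hfin : IsGenericallyFinite f) (j : Fin n) :
    ∃ l, (restrictLine j (f l)).natDegree ≠ 0 := by
  by_contra! hcon
  obtain ⟨U, hU, hdense, hfib⟩ := hfin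
  have h0 : toMap f 0 ∈ imageClosure f := subset_closure ⟨0, rfl⟩
  obtain ⟨y, hyU, hyY⟩ := closure_nonempty_iff.1 ⟨_, hdense h0⟩
  obtain ⟨_, hvU, x, rfl⟩ := mem_closure_iff.1 hyY U hU hyU
  have hinj : Function.Injective fun s : K => x + Pi.single j s := fun s t h =>
    Pi.single_injective j (add_left_cancel h)
  refine Set.infinite_of_injective_forall_mem hinj (fun s => ?_)
    (hfib _ ⟨hvU, subset_closure ⟨x, rfl⟩⟩)
  refine funext fun l => ?_
  change eval _ (f l) = eval x (f l)
  rw [← eval₂_restrictLine, Polynomial.eq_C_of_natDegree_eq_zero (hcon l), Polynomial.eval₂_C,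
    coeff_zero_restrictLine]

/-- On the line, the only coordinate is integral over any nonconstant polynomial in it. -/
theorem coordinateDenominators_eq_top_of_subsingleton [Subsingleton (Fin n)]
    (f : Fin m → MvPolynomial (Fin n) K) (i : Fin n)
    (h : ∃ l, (restrictLine i (f l)).natDegree ≠ 0) : coordinateDenominators f i = ⊤ := by
  obtain ⟨l, hl⟩ := h
  let p : Polynomial K := aeval (fun _ : Fin n => (Polynomial.X : Polynomial K)) (f l)
  have hp : Polynomial.aeval (X i : MvPolynomial (Fin n) K) p = f l := by
    have e : (Polynomial.aeval (X i : MvPolynomial (Fin n) K)).comp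
        (aeval (fun _ : Fin n => (Polynomial.X : Polynomial K))) = AlgHom.id K _ := by
      ext t
      simp [Subsingleton.elim t i]
    exact DFunLike.congr_fun e (f l)
  have hdeg : p.natDegree ≠ 0 := fun h0 => hl <| by
    rw [Polynomial.eq_C_of_natDegree_eq_zero h0, Polynomial.aeval_C] at hp
    rw [← hp, AlgHom.commutes, Polynomial.algebraMap_apply, Polynomial.natDegree_C]
  rw [Ideal.eq_top_iff_one, coordinateDenominators, mem_denominatorIdeal, map_one, one_mul]
  exact isIntegralElem_of_aeval_eq (aeval f) p hdeg (X i) (X l) (by rw [hp, aeval_X])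

theorem hasUniruledDegreeAtMost_nonProperSet [IsAlgClosed K] {d : ℕ}
    (f : Fin m → MvPolynomial (Fin n) K) (hfin : IsGenericallyFinite f) (hdeg : mapDegree f = d) :
    HasUniruledDegreeAtMost d (nonProperSet f) := by
  have hd (l) : (f l).totalDegree ≤ d :=
    hdeg ▸ Finset.le_sup (f := fun l => (f l).totalDegree) (Finset.mem_univ l)
  intro V hV x hx
  rw [nonProperSet_eq_zeroLocus] at hV
  set S := zeroLocus K (Finset.univ.inf (coordinateDenominators f))
  have hVirr : IsIrreducible V := hV.prop.1
  have hVcl : IsClosed V := closure_subset_iff_isClosed.1 <| hV.le_of_ge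
    ⟨hVirr.closure, closure_minimal hV.prop.2 (isClosed_zeroLocus _)⟩ subset_closure
  have hP := isPrime_vanishingIdeal_of_isIrreducible hVirr
  have hPV := zeroLocus_vanishingIdeal_of_isClosed hVcl
  set P := vanishingIdeal K V
  obtain ⟨i, hi⟩ : ∃ i, coordinateDenominators f i ≤ P := by
    have hle : Finset.univ.inf (coordinateDenominators f) ≤ P :=
      le_zeroLocus_iff_le_vanishingIdeal.1 hV.prop.2
    obtain ⟨i, -, hi⟩ := (Ideal.IsPrime.inf_le' hP).1 hle
    exact ⟨i, hi⟩
  obtain ⟨j, hij⟩ : ∃ j, i ≠ j := by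
    by_contra! hall
    have : Subsingleton (Fin n) := ⟨fun a b => (hall a).symm.trans (hall b)⟩
    exact hP.ne_top (top_le_iff.1 (coordinateDenominators_eq_top_of_subsingleton f i
      (hfin.exists_natDegree_restrictLine_ne_zero i) ▸ hi))
  obtain ⟨k, _, _, φ, hφd, hφne, hφJ, hφP⟩ := exists_curve_of_coordinateDenominators_le f hd P hij
    hi (hfin.exists_natDegree_restrictLine_ne_zero j)
  -- The closure of the limit curve lies in the non-properness set and contains `V`, so it is `V`.
  let Q : Ideal (MvPolynomial (Fin m) K) :=
    RingHom.ker (aeval φ : MvPolynomial (Fin m) K →ₐ[K] Polynomial k)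
  have hQ : Q.IsPrime := RingHom.ker_isPrime _
  have hQirr : IsIrreducible (zeroLocus K Q) := isIrreducible_of_isPrime_vanishingIdeal <| by
    rwa [IsPrime.vanishingIdeal_zeroLocus]
  have hQS : zeroLocus K Q ⊆ S := zeroLocus_anti_mono
    ((Finset.inf_le (Finset.mem_univ i)).trans fun p hp => hφJ p hp)
  have hQP : Q ≤ P := fun p hp => by
    have hp' : aeval φ p = 0 := hp
    rw [← hφP, aeval_coeff_zero, hp', Polynomial.coeff_zero]
  have hQV : zeroLocus K Q ⊆ V :=
    hV.le_of_ge ⟨hQirr, hQS⟩ (hPV ▸ zeroLocus_anti_mono hQP)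
  have hPQ : P ≤ Q := by
    rw [← IsPrime.vanishingIdeal_zeroLocus (K := K) Q]
    exact vanishingIdeal_anti_mono hQV
  obtain ⟨k', _, _, φ', hφd', hφne', hφx', hφ'⟩ := exists_curve_through_specialization φ hφd hφne x
    fun p hp => by
      have := (hφP p).1 hp x hx
      rwa [aeval_eq_eval] at this
  obtain ⟨ψ, hψd, hψne, hψx, hψ⟩ := exists_curve_over_base φ' hφne' x hφx'
  refine ⟨Set.range (paramMap ψ), ?_, ⟨0, funext fun l => ?_⟩,
    isParametricCurve_range ψ (fun l => (hψd l).trans (hφd' l)) hψne⟩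
  · rintro _ ⟨t, rfl⟩
    rw [← hPV]
    intro p hp
    rw [aeval_eq_eval]
    exact (eval_paramMap ψ t p).trans (by rw [hψ p (hφ' p (hPQ hp)), Polynomial.eval_zero])
  · rw [← hψx, Polynomial.coeff_zero_eq_eval_zero]
    rfl

end

end AffineGeometry

end

theorem mainTheorem6 {K : Type*} [Field K] [IsAlgClosed K] {n m d : ℕ}
    (f : Fin m → MvPolynomial (Fin n) K)
    (hfin : AffineGeometry.IsGenericallyFinite f) (hdeg : AffineGeometry.mapDegree f = d) :
    AffineGeometry.nonProperSet f = ∅ ∨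
      (AffineGeometry.IsAffineVariety (AffineGeometry.nonProperSet f) ∧
        AffineGeometry.HasUniruledDegreeAtMost d (AffineGeometry.nonProperSet f)) :=
  Or.inr ⟨⟨_, AffineGeometry.nonProperSet_eq_zeroLocus f⟩,
    AffineGeometry.hasUniruledDegreeAtMost_nonProperSet f hfin hdeg⟩
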